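/- All games are short (finite) partizan games $G=\{G^{\mathcal L}\mid G^{\mathcal R}\}$ under mis\`ere play (a player unable to move on their turn wins). Write $G\ge H$ if $o(G+X)\ge o(H+X)$ for every game $X$, where $+$ is the disjunctive sum and $o$ is the mis\`ere outcome (outcomes being ordered as usual in favour of Left), and $G=H$ if $G\ge H$ and $H\ge G$. A \emph{Left dead end} is a game in which no subposition (including the game itself) has a Left option. The Left dead ends, up to $=$, form a commutative monoid $\mathcal L$ under $+$. In $\mathcal L$, an \emph{atom} is a non-invertible element $a$ such that $a=b+c$ implies that $b$ or $c$ is invertible; a \emph{prime} is a non-invertible element $p$ such that $p\mid a+b$ implies $p\mid a$ or $p\mid b$ (where $x\mid y$ means $y=x+z$ for some $z\in\mathcal L$). A \emph{factorisation} of an element is an expression of it as a finite (possibly empty) sum of atoms. An element is \emph{prime-factorisable} if it has a factorisation all of whose terms are prime, and \emph{uniquely factorisable} if it has exactly one factorisation up to rearrangement. The \emph{race} of a game $G$ is the least $n$ for which there is a sequence $G=G_0,G_1,\dots,G_n$ in which each $G_{i+1}$ is an option of $G_i$ and $G_n$ has no options. The \emph{birthday} of $G$ is the least height of the game tree of a game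 equal to $G$. Let $G$ be a Left dead end. An option $G'$ of $G$ is \emph{good} if there is no option $G''$ of $G$ with $G'>G''$; it is a \emph{racing option} if $\mathrm{race}(G')=\mathrm{race}(G)-1$, and a \emph{stalling option} if $\mathrm{birth}(G')=\mathrm{birth}(G)-1$. \textbf{Theorem.} Let $\mathcal S$ be a set of Left dead ends, each of which is an atom of $\mathcal L$. (a) If every good racing option of every $G\in\mathcal S$ is prime-factorisable, then every finite sum of elements of $\mathcal S$ (with repetitions allowed) is uniquely factorisable. (b) If every good stalling option of every $G\in\mathcal S$ is prime-factorisable, then every finite sum of elements of $\mathcal S$ (with repetitions allowed) is uniquely factorisable. -/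

import Mathlib

/-- Forms of short partizan games: finitely many Left options and finitely many Right options. -/
inductive ShortGame : Type
  | mk (m n : ℕ) (L : Fin m → ShortGame) (R : Fin n → ShortGame) : ShortGame

/-- The two players. -/
inductive Player : Type
  | left
  | right

namespace ShortGame

/-- The set of Left options. -/
def leftOptions : ShortGame → Set ShortGame
  | mk _ _ L _ => Set.range L

/-- The set of Right options. -/
def rightOptions : ShortGame → Set ShortGame
  | mk _ _ _ R => Set.range R

/-- The set of all options, of either player. -/
def options (G : ShortGame) : Set ShortGame := G.leftOptions ∪ G.rightOptions

/-- The empty game `{ · | · }`. -/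
instance : Zero ShortGame := ⟨mk 0 0 Fin.elim0 Fin.elim0⟩

/-- The disjunctive sum: a move in `G + H` is a move in exactly one of the components
(see `mem_leftOptions_add` and `mem_rightOptions_add`). -/
noncomputable def add (G : ShortGame) : ShortGame → ShortGame :=
  ShortGame.rec (motive := fun _ => ShortGame → ShortGame)
    (fun m n _ _ addL addR H =>
      ShortGame.rec (motive := fun _ => ShortGame)
        (fun m' n' L' R' addL' addR' =>
          mk (m + m') (n + n')
            (Fin.addCases (fun i => addL i (mk m' n' L' R')) addL')
            (Fin.addCases (fun i => addR i (mk m' n' L' R')) addR'))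
        H)
    G

noncomputable instance : Add ShortGame := ⟨add⟩

/-- `G.winsFirst p`: under the misère convention (a player who cannot move on their turn wins),
player `p` wins `G` when moving first. -/
def winsFirst : ShortGame → Player → Prop
  | mk m _ L _, .left => m = 0 ∨ ∃ i, ¬ (L i).winsFirst .right
  | mk _ n _ R, .right => n = 0 ∨ ∃ j, ¬ (R j).winsFirst .left

/-- The misère outcome, as the pair (Left wins moving first, Left wins moving second).
In the product order of `Prop × Prop` the four outcomes are ordered as usual: the outcome
"Left wins" is largest, "Right wins" is smallest, and "the next player wins" and
"the previous player wins" are incomparable. -/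
def outcome (G : ShortGame) : Prop × Prop := (G.winsFirst .left, ¬ G.winsFirst .right)

/-- Comparison modulo the full misère universe: `H ≤ G` if the outcome of `H + X` is at most
that of `G + X` for every game `X`. -/
instance : Preorder ShortGame where
  le H G := ∀ X : ShortGame, outcome (H + X) ≤ outcome (G + X)
  le_refl _ _ := le_refl _
  le_trans _ _ _ h₁ h₂ X := le_trans (h₁ X) (h₂ X)

/-- Equality of games modulo the full misère universe. -/
def MisereEq (G H : ShortGame) : Prop := AntisymmRel (· ≤ ·) G H

/-- `H` is a subposition of `G` (possibly `G` itself). -/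
def IsSubposition (H G : ShortGame) : Prop :=
  Relation.ReflTransGen (fun A B : ShortGame => A ∈ B.options) H G

/-- A Left end is a game without Left options. -/
def IsLeftEnd (G : ShortGame) : Prop := G.leftOptions = ∅

/-- A Left dead end is a game all of whose subpositions are Left ends. -/
def IsLeftDeadEnd (G : ShortGame) : Prop := ∀ H, IsSubposition H G → H.IsLeftEnd

/-- The height of the game tree. -/
def formalBirthday : ShortGame → ℕ
  | mk _ _ L R =>
    max (Finset.univ.sup fun i => (L i).formalBirthday + 1)
      (Finset.univ.sup fun j => (R j).formalBirthday + 1)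

/-- The birthday: the least formal birthday of a form that is equal to `G`. -/
noncomputable def birthday (G : ShortGame) : ℕ :=
  sInf {n | ∃ H : ShortGame, MisereEq G H ∧ H.formalBirthday = n}

/-- `HasTerminalRun G n`: there is a run `G = G₀, G₁, …, Gₙ`, in which each term is an option
(of either player) of the one before it and the last term has no options. -/
inductive HasTerminalRun : ShortGame → ℕ → Prop
  | zero {G : ShortGame} (h : G.options = ∅) : HasTerminalRun G 0
  | succ {G G' : ShortGame} {n : ℕ} (h : G' ∈ G.options) (h' : HasTerminalRun G' n) :
      HasTerminalRun G (n + 1)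

/-- The set of terminal lengths. -/
def terminalLengths (G : ShortGame) : Set ℕ := {n | HasTerminalRun G n}

/-- The race: the least terminal length. -/
noncomputable def race (G : ShortGame) : ℕ := sInf G.terminalLengths

/-- A good option: one that is not strictly dominated by another option of the same player.
Left prefers larger options and Right prefers smaller ones. -/
def IsGoodOption (G' G : ShortGame) : Prop :=
  (G' ∈ G.leftOptions ∧ ¬ ∃ G'' ∈ G.leftOptions, G' < G'') ∨
    (G' ∈ G.rightOptions ∧ ¬ ∃ G'' ∈ G.rightOptions, G'' < G')

/-- A racing option of `G`: an option whose race is one less than that of `G`. -/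
def IsRacingOption (G' G : ShortGame) : Prop :=
  G' ∈ G.options ∧ G'.race + 1 = G.race

/-- A stalling option of `G`: an option whose birthday is one less than that of `G`. -/
def IsStallingOption (G' G : ShortGame) : Prop :=
  G' ∈ G.options ∧ G'.birthday + 1 = G.birthday

section Lemmas

theorem mem_leftOptions_add {G H K : ShortGame} :
    K ∈ (G + H).leftOptions ↔
      (∃ G' ∈ G.leftOptions, K = G' + H) ∨ (∃ H' ∈ H.leftOptions, K = G + H') := by
  cases G with | mk m n L R => cases H with | mk m' n' L' R' =>
  constructor
  · rintro ⟨i, rfl⟩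
    refine Fin.addCases (fun i => ?_) (fun i => ?_) i
    · exact Or.inl ⟨L i, ⟨i, rfl⟩, Fin.addCases_left i⟩
    · exact Or.inr ⟨L' i, ⟨i, rfl⟩, Fin.addCases_right i⟩
  · rintro (⟨_, ⟨i, rfl⟩, rfl⟩ | ⟨_, ⟨i, rfl⟩, rfl⟩)
    · exact ⟨Fin.castAdd _ i, Fin.addCases_left i⟩
    · exact ⟨Fin.natAdd _ i, Fin.addCases_right i⟩

theorem mem_rightOptions_add {G H K : ShortGame} :
    K ∈ (G + H).rightOptions ↔
      (∃ G' ∈ G.rightOptions, K = G' + H) ∨ (∃ H' ∈ H.rightOptions, K = G + H') := by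
  cases G with | mk m n L R => cases H with | mk m' n' L' R' =>
  constructor
  · rintro ⟨i, rfl⟩
    refine Fin.addCases (fun i => ?_) (fun i => ?_) i
    · exact Or.inl ⟨R i, ⟨i, rfl⟩, Fin.addCases_left i⟩
    · exact Or.inr ⟨R' i, ⟨i, rfl⟩, Fin.addCases_right i⟩
  · rintro (⟨_, ⟨i, rfl⟩, rfl⟩ | ⟨_, ⟨i, rfl⟩, rfl⟩)
    · exact ⟨Fin.castAdd _ i, Fin.addCases_left i⟩
    · exact ⟨Fin.natAdd _ i, Fin.addCases_right i⟩

theorem not_mem_leftOptions_zero {K : ShortGame} : K ∉ (0 : ShortGame).leftOptions := by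
  rintro ⟨i, _⟩; exact i.elim0

theorem not_mem_rightOptions_zero {K : ShortGame} : K ∉ (0 : ShortGame).rightOptions := by
  rintro ⟨i, _⟩; exact i.elim0

theorem winsFirst_left_iff (G : ShortGame) :
    G.winsFirst .left ↔ G.leftOptions = ∅ ∨ ∃ G' ∈ G.leftOptions, ¬ G'.winsFirst .right := by
  cases G with | mk m n L R =>
  simp [winsFirst, leftOptions, Set.range_eq_empty_iff, ← not_nonempty_iff,
    ← Fin.pos_iff_nonempty]

theorem winsFirst_right_iff (G : ShortGame) :
    G.winsFirst .right ↔ G.rightOptions = ∅ ∨ ∃ G' ∈ G.rightOptions, ¬ G'.winsFirst .left := by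
  cases G with | mk m n L R =>
  simp [winsFirst, rightOptions, Set.range_eq_empty_iff, ← not_nonempty_iff,
    ← Fin.pos_iff_nonempty]

/-- Induction on options. -/
theorem option_induction {P : ShortGame → Prop}
    (h : ∀ G, (∀ G' ∈ G.leftOptions, P G') → (∀ G' ∈ G.rightOptions, P G') → P G)
    (G : ShortGame) : P G := by
  induction G with | mk m n L R hL hR =>
  exact h _ (by rintro _ ⟨i, rfl⟩; exact hL i) (by rintro _ ⟨i, rfl⟩; exact hR i)

/-- Isomorphism of game trees, up to order and repetition of options. -/
def Iso : ShortGame → ShortGame → Prop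
  | mk _ _ L R, mk _ _ L' R' =>
    ((∀ i, ∃ j, Iso (L i) (L' j)) ∧ (∀ j, ∃ i, Iso (L i) (L' j))) ∧
      ((∀ i, ∃ j, Iso (R i) (R' j)) ∧ (∀ j, ∃ i, Iso (R i) (R' j)))

theorem iso_iff (G H : ShortGame) : Iso G H ↔
    ((∀ G' ∈ G.leftOptions, ∃ H' ∈ H.leftOptions, Iso G' H') ∧
      (∀ H' ∈ H.leftOptions, ∃ G' ∈ G.leftOptions, Iso G' H')) ∧
    ((∀ G' ∈ G.rightOptions, ∃ H' ∈ H.rightOptions, Iso G' H') ∧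
      (∀ H' ∈ H.rightOptions, ∃ G' ∈ G.rightOptions, Iso G' H')) := by
  cases G; cases H; simp [Iso, leftOptions, rightOptions]

theorem Iso.winsFirst_iff {G : ShortGame} : ∀ {H : ShortGame}, Iso G H →
    (G.winsFirst .left ↔ H.winsFirst .left) ∧ (G.winsFirst .right ↔ H.winsFirst .right) := by
  induction G using option_induction with | h G hL hR =>
  intro H h
  obtain ⟨⟨h₁, h₂⟩, ⟨h₃, h₄⟩⟩ := (iso_iff G H).1 h
  rw [winsFirst_left_iff, winsFirst_left_iff, winsFirst_right_iff, winsFirst_right_iff]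
  simp only [Set.eq_empty_iff_forall_notMem]
  refine ⟨or_congr ⟨fun e x hx => ?_, fun e x hx => ?_⟩ ⟨?_, ?_⟩,
    or_congr ⟨fun e x hx => ?_, fun e x hx => ?_⟩ ⟨?_, ?_⟩⟩
  · obtain ⟨y, hy, -⟩ := h₂ x hx; exact e y hy
  · obtain ⟨y, hy, -⟩ := h₁ x hx; exact e y hy
  · rintro ⟨x, hx, hw⟩
    obtain ⟨y, hy, i⟩ := h₁ x hx
    exact ⟨y, hy, fun c => hw ((hL x hx i).2.2 c)⟩
  · rintro ⟨x, hx, hw⟩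
    obtain ⟨y, hy, i⟩ := h₂ x hx
    exact ⟨y, hy, fun c => hw ((hL y hy i).2.1 c)⟩
  · obtain ⟨y, hy, -⟩ := h₄ x hx; exact e y hy
  · obtain ⟨y, hy, -⟩ := h₃ x hx; exact e y hy
  · rintro ⟨x, hx, hw⟩
    obtain ⟨y, hy, i⟩ := h₃ x hx
    exact ⟨y, hy, fun c => hw ((hR x hx i).1.2 c)⟩
  · rintro ⟨x, hx, hw⟩
    obtain ⟨y, hy, i⟩ := h₄ x hx
    exact ⟨y, hy, fun c => hw ((hR y hy i).1.1 c)⟩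

theorem Iso.outcome_eq {G H : ShortGame} (h : Iso G H) : outcome G = outcome H := by
  simp only [outcome, h.winsFirst_iff.1, h.winsFirst_iff.2]

theorem Iso.refl (G : ShortGame) : Iso G G := by
  induction G using option_induction with | h G hL hR =>
  rw [iso_iff]
  exact ⟨⟨fun x hx => ⟨x, hx, hL x hx⟩, fun x hx => ⟨x, hx, hL x hx⟩⟩,
    ⟨fun x hx => ⟨x, hx, hR x hx⟩, fun x hx => ⟨x, hx, hR x hx⟩⟩⟩

theorem iso_zero_add (G : ShortGame) : Iso (0 + G) G := by
  induction G using option_induction with | h G hL hR =>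
  rw [iso_iff]
  simp only [mem_leftOptions_add, mem_rightOptions_add, not_mem_leftOptions_zero,
    not_mem_rightOptions_zero, false_and, exists_false, false_or]
  refine ⟨⟨?_, fun x hx => ⟨_, ⟨x, hx, rfl⟩, hL x hx⟩⟩,
    ⟨?_, fun x hx => ⟨_, ⟨x, hx, rfl⟩, hR x hx⟩⟩⟩
  · rintro _ ⟨x, hx, rfl⟩; exact ⟨x, hx, hL x hx⟩
  · rintro _ ⟨x, hx, rfl⟩; exact ⟨x, hx, hR x hx⟩

theorem iso_add_comm (G H : ShortGame) : Iso (G + H) (H + G) := by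
  induction G using option_induction generalizing H with | h G hL hR =>
  induction H using option_induction with | h H kL kR =>
  rw [iso_iff]
  simp only [mem_leftOptions_add, mem_rightOptions_add]
  refine ⟨⟨?_, ?_⟩, ⟨?_, ?_⟩⟩
  · rintro _ (⟨x, hx, rfl⟩ | ⟨x, hx, rfl⟩)
    · exact ⟨_, Or.inr ⟨x, hx, rfl⟩, hL x hx H⟩
    · exact ⟨_, Or.inl ⟨x, hx, rfl⟩, kL x hx⟩
  · rintro _ (⟨x, hx, rfl⟩ | ⟨x, hx, rfl⟩)
    · exact ⟨_, Or.inr ⟨x, hx, rfl⟩, kL x hx⟩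
    · exact ⟨_, Or.inl ⟨x, hx, rfl⟩, hL x hx H⟩
  · rintro _ (⟨x, hx, rfl⟩ | ⟨x, hx, rfl⟩)
    · exact ⟨_, Or.inr ⟨x, hx, rfl⟩, hR x hx H⟩
    · exact ⟨_, Or.inl ⟨x, hx, rfl⟩, kR x hx⟩
  · rintro _ (⟨x, hx, rfl⟩ | ⟨x, hx, rfl⟩)
    · exact ⟨_, Or.inr ⟨x, hx, rfl⟩, kR x hx⟩
    · exact ⟨_, Or.inl ⟨x, hx, rfl⟩, hR x hx H⟩

theorem iso_add_assoc (G H K : ShortGame) : Iso (G + H + K) (G + (H + K)) := by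
  induction G using option_induction generalizing H K with | h G hL hR =>
  induction H using option_induction generalizing K with | h H kL kR =>
  induction K using option_induction with | h K lL lR =>
  rw [iso_iff]
  simp only [mem_leftOptions_add, mem_rightOptions_add]
  refine ⟨⟨?_, ?_⟩, ⟨?_, ?_⟩⟩
  · rintro _ (⟨_, ⟨x, hx, rfl⟩ | ⟨x, hx, rfl⟩, rfl⟩ | ⟨x, hx, rfl⟩)
    · exact ⟨_, Or.inl ⟨x, hx, rfl⟩, hL x hx H K⟩
    · exact ⟨_, Or.inr ⟨_, Or.inl ⟨x, hx, rfl⟩, rfl⟩, kL x hx K⟩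
    · exact ⟨_, Or.inr ⟨_, Or.inr ⟨x, hx, rfl⟩, rfl⟩, lL x hx⟩
  · rintro _ (⟨x, hx, rfl⟩ | ⟨_, ⟨x, hx, rfl⟩ | ⟨x, hx, rfl⟩, rfl⟩)
    · exact ⟨_, Or.inl ⟨_, Or.inl ⟨x, hx, rfl⟩, rfl⟩, hL x hx H K⟩
    · exact ⟨_, Or.inl ⟨_, Or.inr ⟨x, hx, rfl⟩, rfl⟩, kL x hx K⟩
    · exact ⟨_, Or.inr ⟨x, hx, rfl⟩, lL x hx⟩
  · rintro _ (⟨_, ⟨x, hx, rfl⟩ | ⟨x, hx, rfl⟩, rfl⟩ | ⟨x, hx, rfl⟩)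
    · exact ⟨_, Or.inl ⟨x, hx, rfl⟩, hR x hx H K⟩
    · exact ⟨_, Or.inr ⟨_, Or.inl ⟨x, hx, rfl⟩, rfl⟩, kR x hx K⟩
    · exact ⟨_, Or.inr ⟨_, Or.inr ⟨x, hx, rfl⟩, rfl⟩, lR x hx⟩
  · rintro _ (⟨x, hx, rfl⟩ | ⟨_, ⟨x, hx, rfl⟩ | ⟨x, hx, rfl⟩, rfl⟩)
    · exact ⟨_, Or.inl ⟨_, Or.inl ⟨x, hx, rfl⟩, rfl⟩, hR x hx H K⟩
    · exact ⟨_, Or.inl ⟨_, Or.inr ⟨x, hx, rfl⟩, rfl⟩, kR x hx K⟩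
    · exact ⟨_, Or.inr ⟨x, hx, rfl⟩, lR x hx⟩

theorem Iso.add_right {G H : ShortGame} (h : Iso G H) (K : ShortGame) : Iso (G + K) (H + K) := by
  induction G using option_induction generalizing H K with | h G hL hR =>
  induction K using option_induction with | h K kL kR =>
  obtain ⟨⟨h₁, h₂⟩, ⟨h₃, h₄⟩⟩ := (iso_iff G H).1 h
  rw [iso_iff]
  simp only [mem_leftOptions_add, mem_rightOptions_add]
  refine ⟨⟨?_, ?_⟩, ⟨?_, ?_⟩⟩
  · rintro _ (⟨x, hx, rfl⟩ | ⟨x, hx, rfl⟩)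
    · obtain ⟨y, hy, i⟩ := h₁ x hx; exact ⟨_, Or.inl ⟨y, hy, rfl⟩, hL x hx i K⟩
    · exact ⟨_, Or.inr ⟨x, hx, rfl⟩, kL x hx⟩
  · rintro _ (⟨x, hx, rfl⟩ | ⟨x, hx, rfl⟩)
    · obtain ⟨y, hy, i⟩ := h₂ x hx; exact ⟨_, Or.inl ⟨y, hy, rfl⟩, hL y hy i K⟩
    · exact ⟨_, Or.inr ⟨x, hx, rfl⟩, kL x hx⟩
  · rintro _ (⟨x, hx, rfl⟩ | ⟨x, hx, rfl⟩)
    · obtain ⟨y, hy, i⟩ := h₃ x hx; exact ⟨_, Or.inl ⟨y, hy, rfl⟩, hR x hx i K⟩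
    · exact ⟨_, Or.inr ⟨x, hx, rfl⟩, kR x hx⟩
  · rintro _ (⟨x, hx, rfl⟩ | ⟨x, hx, rfl⟩)
    · obtain ⟨y, hy, i⟩ := h₄ x hx; exact ⟨_, Or.inl ⟨y, hy, rfl⟩, hR y hy i K⟩
    · exact ⟨_, Or.inr ⟨x, hx, rfl⟩, kR x hx⟩

theorem Iso.misereEq {G H : ShortGame} (h : Iso G H) : MisereEq G H :=
  ⟨fun X => (h.add_right X).outcome_eq.le, fun X => (h.add_right X).outcome_eq.ge⟩

theorem add_le_add_right' {G H : ShortGame} (h : G ≤ H) (K : ShortGame) : G + K ≤ H + K := by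
  intro X
  rw [(iso_add_assoc G K X).outcome_eq, (iso_add_assoc H K X).outcome_eq]
  exact h (K + X)

theorem MisereEq.add {G G' H H' : ShortGame} (h : MisereEq G G') (h' : MisereEq H H') :
    MisereEq (G + H) (G' + H') := by
  have key : ∀ {A A' B B' : ShortGame}, A ≤ A' → B ≤ B' → A + B ≤ A' + B' := by
    intro A A' B B' hA hB
    exact (add_le_add_right' hA B).trans ((iso_add_comm A' B).misereEq.1.trans
      ((add_le_add_right' hB A').trans (iso_add_comm B' A').misereEq.1))
  exact ⟨key h.1 h'.1, key h.2 h'.2⟩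

theorem isLeftDeadEnd_iff (G : ShortGame) :
    G.IsLeftDeadEnd ↔ G.leftOptions = ∅ ∧ ∀ G' ∈ G.rightOptions, G'.IsLeftDeadEnd := by
  constructor
  · intro h
    exact ⟨h G .refl, fun G' hG' H hH => h H (hH.tail (Or.inr hG'))⟩
  · rintro ⟨h, h'⟩ H hH
    rcases Relation.ReflTransGen.cases_tail hH with rfl | ⟨K, hK, hKG⟩
    · exact h
    · rcases hKG with hKG | hKG
      · rw [h] at hKG; exact hKG.elim
      · exact h' K hKG H hK

theorem isLeftDeadEnd_zero : (0 : ShortGame).IsLeftDeadEnd := by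
  rw [isLeftDeadEnd_iff]
  exact ⟨Set.eq_empty_of_forall_notMem fun _ => not_mem_leftOptions_zero,
    fun _ h => (not_mem_rightOptions_zero h).elim⟩

theorem IsLeftDeadEnd.add {G H : ShortGame} (hG : G.IsLeftDeadEnd) (hH : H.IsLeftDeadEnd) :
    (G + H).IsLeftDeadEnd := by
  induction G using option_induction generalizing H with | h G hL hR =>
  induction H using option_induction with | h H kL kR =>
  obtain ⟨g₁, g₂⟩ := (isLeftDeadEnd_iff G).1 hG
  obtain ⟨h₁, h₂⟩ := (isLeftDeadEnd_iff H).1 hH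
  rw [isLeftDeadEnd_iff]
  refine ⟨Set.eq_empty_of_forall_notMem fun K hK => ?_, fun K hK => ?_⟩
  · rw [mem_leftOptions_add, g₁, h₁] at hK
    simp at hK
  · rcases mem_rightOptions_add.1 hK with ⟨x, hx, rfl⟩ | ⟨x, hx, rfl⟩
    · exact hR x hx (g₂ x hx) hH
    · exact kR x hx (h₂ x hx)

end Lemmas

end ShortGame

/-- The forms of short games that are Left dead ends. -/
abbrev LeftDeadEnd : Type := {G : ShortGame // G.IsLeftDeadEnd}

/-- Left dead ends up to equality modulo the full misère universe. -/
def LeftDeadEndMonoid : Type := Antisymmetrization LeftDeadEnd (· ≤ ·)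

namespace LeftDeadEnd

/-- The class of a Left dead end modulo misère equality. -/
def value (G : LeftDeadEnd) : LeftDeadEndMonoid := toAntisymmetrization (· ≤ ·) G

theorem value_eq_value_iff {G H : LeftDeadEnd} :
    G.value = H.value ↔ ShortGame.MisereEq G.1 H.1 := Quotient.eq''

end LeftDeadEnd

noncomputable instance : Add LeftDeadEndMonoid :=
  ⟨Quotient.map₂ (fun G H : LeftDeadEnd => ⟨G.1 + H.1, G.2.add H.2⟩)
    (fun _ _ h _ _ h' => ShortGame.MisereEq.add h h')⟩

instance : Zero LeftDeadEndMonoid := ⟨LeftDeadEnd.value ⟨0, ShortGame.isLeftDeadEnd_zero⟩⟩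

/-- The commutative monoid of Left dead ends under disjunctive sum. -/
noncomputable instance : AddCommMonoid LeftDeadEndMonoid where
  add_assoc := by
    rintro ⟨G⟩ ⟨H⟩ ⟨K⟩
    exact LeftDeadEnd.value_eq_value_iff.2 (ShortGame.iso_add_assoc G.1 H.1 K.1).misereEq
  zero_add := by
    rintro ⟨G⟩
    exact LeftDeadEnd.value_eq_value_iff.2 (ShortGame.iso_zero_add G.1).misereEq
  add_zero := by
    rintro ⟨G⟩
    exact LeftDeadEnd.value_eq_value_iff.2
      ((ShortGame.iso_add_comm G.1 0).misereEq.trans (ShortGame.iso_zero_add G.1).misereEq)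
  add_comm := by
    rintro ⟨G⟩ ⟨H⟩
    exact LeftDeadEnd.value_eq_value_iff.2 (ShortGame.iso_add_comm G.1 H.1).misereEq
  nsmul := nsmulRec

theorem LeftDeadEnd.value_add (G H : LeftDeadEnd) :
    LeftDeadEnd.value ⟨G.1 + H.1, G.2.add H.2⟩ = G.value + H.value := rfl

section Factorisation

variable {M : Type*} [AddCommMonoid M]

/-- `p` is prime in an additive commutative monoid: it is not invertible, and whenever it divides
a sum, it divides one of the summands (`p` divides `a` if `a = p + c` for some `c`). -/
def IsAddPrime (p : M) : Prop :=
  ¬ IsAddUnit p ∧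
    ∀ a b : M, (∃ c, p + c = a + b) → (∃ c, p + c = a) ∨ (∃ c, p + c = b)

/-- A factorisation of `m`: a finite multiset of atoms with sum `m`. -/
def IsFactorisation (s : Multiset M) (m : M) : Prop :=
  (∀ a ∈ s, AddIrreducible a) ∧ s.sum = m

/-- `m` has a factorisation consisting of primes. -/
def IsPrimeFactorisable (m : M) : Prop :=
  ∃ s : Multiset M, IsFactorisation s m ∧ ∀ p ∈ s, IsAddPrime p

/-- `m` has exactly one factorisation up to rearrangement. -/
def IsUniquelyFactorisable (m : M) : Prop :=
  ∃! s : Multiset M, IsFactorisation s m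

end Factorisation

/-! ### Misère play, test games and the order on Left dead ends -/

namespace ShortGame

/-! For Left dead ends, `H ≤ G` holds exactly when each Right option of `G` is answered by a smaller
Right option of `H`, and `H` has no options if `G` has none. Necessity comes from explicit test
games, sufficiency from copying moves. It follows that race increases and birthday decreases along
the order, that both are additive, and that sums can be cancelled
(`IsLeftDeadEnd.le_of_add_le_add_right`). The monoid is therefore cancellative with trivial units,
and every element has a factorisation.

Call a good option lowering the race (or the birthday) by one a good step. Good steps depend only on
the value, exist from every nonzero value, and from a sum are good steps in one summand. Let a sum
of atoms of the given set have two factorisations `s` and `t`. Common atoms cancel, so assume there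
are none, and read one step `x'` of the sum in both: it replaces some `a` in `s` by `a'`, and some
`b` in `t` by `b'`. Since `a'` is a sum of primes and the rest of `s` factorises uniquely by
induction, so does `x'`. An atom of `t` other than the replaced `b` survives in `x'`, so it lies in
`s` or is a prime dividing the sum of `s`; either way it is common to both. This is
`eq_of_sum_eq_of_steps`. -/

theorem winsFirst_left_of_move {G G' : ShortGame} (h : G' ∈ G.leftOptions)
    (h' : ¬ G'.winsFirst .right) : G.winsFirst .left :=
  (winsFirst_left_iff G).2 (Or.inr ⟨G', h, h'⟩)

theorem winsFirst_right_of_move {G G' : ShortGame} (h : G' ∈ G.rightOptions)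
    (h' : ¬ G'.winsFirst .left) : G.winsFirst .right :=
  (winsFirst_right_iff G).2 (Or.inr ⟨G', h, h'⟩)

/-- A stuck player wins, so losing requires some move to exist; `h` supplies one. -/
theorem not_winsFirst_left {G G' : ShortGame} (h : G' ∈ G.leftOptions)
    (h' : ∀ K ∈ G.leftOptions, K.winsFirst .right) : ¬ G.winsFirst .left := by
  rw [winsFirst_left_iff]
  rintro (h₀ | ⟨K, hK, hw⟩)
  · rw [h₀] at h; exact h
  · exact hw (h' K hK)

theorem not_winsFirst_right {G G' : ShortGame} (h : G' ∈ G.rightOptions)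
    (h' : ∀ K ∈ G.rightOptions, K.winsFirst .left) : ¬ G.winsFirst .right := by
  rw [winsFirst_right_iff]
  rintro (h₀ | ⟨K, hK, hw⟩)
  · rw [h₀] at h; exact h
  · exact hw (h' K hK)

theorem formalBirthday_lt_of_mem_leftOptions {G G' : ShortGame} (h : G' ∈ G.leftOptions) :
    G'.formalBirthday < G.formalBirthday := by
  cases G with | mk m n L R =>
  obtain ⟨i, rfl⟩ := h
  exact lt_max_of_lt_left (Finset.le_sup (f := fun i => (L i).formalBirthday + 1)
    (Finset.mem_univ i))

theorem formalBirthday_lt_of_mem_rightOptions {G G' : ShortGame} (h : G' ∈ G.rightOptions) :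
    G'.formalBirthday < G.formalBirthday := by
  cases G with | mk m n L R =>
  obtain ⟨i, rfl⟩ := h
  exact lt_max_of_lt_right (Finset.le_sup (f := fun i => (R i).formalBirthday + 1)
    (Finset.mem_univ i))

theorem finite_rightOptions (G : ShortGame) : G.rightOptions.Finite := by
  cases G; exact Set.finite_range _

/-- The game in which Right has exactly `n` successive moves and Left has none. -/
def rightMoves : ℕ → ShortGame
  | 0 => 0
  | n + 1 => mk 0 1 Fin.elim0 fun _ => rightMoves n

/-- The game in which Left has exactly `n` successive moves and Right has none. -/
def leftMoves : ℕ → ShortGame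
  | 0 => 0
  | n + 1 => mk 1 0 (fun _ => leftMoves n) Fin.elim0

theorem leftOptions_rightMoves (n : ℕ) : (rightMoves n).leftOptions = ∅ := by
  cases n <;> exact Set.range_eq_empty _

theorem rightOptions_rightMoves_succ (n : ℕ) :
    (rightMoves (n + 1)).rightOptions = {rightMoves n} := Set.range_const

theorem rightOptions_leftMoves (n : ℕ) : (leftMoves n).rightOptions = ∅ := by
  cases n <;> exact Set.range_eq_empty _

theorem leftOptions_leftMoves_succ (n : ℕ) :
    (leftMoves (n + 1)).leftOptions = {leftMoves n} := Set.range_const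

/-- Left wins any game to which sufficiently many moves for Right are added. -/
theorem left_wins_add_rightMoves (K : ShortGame) :
    (∀ n, K.formalBirthday ≤ n → (K + rightMoves n).winsFirst .left) ∧
      ∀ n, K.formalBirthday + 1 ≤ n → ¬ (K + rightMoves n).winsFirst .right := by
  induction K using option_induction with | h K hL hR =>
  have left : ∀ n, K.formalBirthday ≤ n → (K + rightMoves n).winsFirst .left := by
    intro n hn
    -- Without a Left option in `K`, Left is stuck in the sum and wins at once.
    rcases K.leftOptions.eq_empty_or_nonempty with h | ⟨K', hK'⟩
    · refine (winsFirst_left_iff _).2 (Or.inl (Set.eq_empty_of_forall_notMem fun A hA => ?_))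
      rw [mem_leftOptions_add, h, leftOptions_rightMoves] at hA
      simp at hA
    · exact winsFirst_left_of_move (mem_leftOptions_add.2 (Or.inl ⟨K', hK', rfl⟩))
        ((hL K' hK').2 n ((formalBirthday_lt_of_mem_leftOptions hK').trans_le hn))
  refine ⟨left, fun n hn => ?_⟩
  -- The extra move keeps Right from being stuck, and pays for his spending one of the added moves.
  obtain ⟨n, rfl⟩ : ∃ k, n = k + 1 := ⟨n - 1, by omega⟩
  have hm : rightMoves n ∈ (rightMoves (n + 1)).rightOptions := by
    rw [rightOptions_rightMoves_succ]; rfl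
  refine not_winsFirst_right (mem_rightOptions_add.2 (Or.inr ⟨_, hm, rfl⟩)) fun A hA => ?_
  rcases mem_rightOptions_add.1 hA with ⟨K', hK', rfl⟩ | ⟨B, hB, rfl⟩
  · have := formalBirthday_lt_of_mem_rightOptions hK'
    exact (hR K' hK').1 _ (by omega)
  · rw [rightOptions_rightMoves_succ, Set.mem_singleton_iff] at hB
    subst hB
    exact left n (by omega)

theorem IsLeftDeadEnd.leftOptions_eq {G : ShortGame} (hG : G.IsLeftDeadEnd) :
    G.leftOptions = ∅ := ((isLeftDeadEnd_iff G).1 hG).1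

theorem IsLeftDeadEnd.of_mem {G G' : ShortGame} (hG : G.IsLeftDeadEnd)
    (h : G' ∈ G.rightOptions) : G'.IsLeftDeadEnd := ((isLeftDeadEnd_iff G).1 hG).2 G' h

theorem IsLeftDeadEnd.options_eq {G : ShortGame} (hG : G.IsLeftDeadEnd) :
    G.options = G.rightOptions := by
  rw [options, hG.leftOptions_eq, Set.empty_union]

/-- Right, moving first, wins a Left dead end to which sufficiently many moves for Left are
added. -/
theorem IsLeftDeadEnd.right_wins_add_leftMoves {K : ShortGame} (hK : K.IsLeftDeadEnd) :
    ∀ n, K.formalBirthday + 1 ≤ n → (K + leftMoves n).winsFirst .right := by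
  induction K using option_induction with | h K hL hR =>
  intro n hn
  rcases K.rightOptions.eq_empty_or_nonempty with h | ⟨K', hK'⟩
  · refine (winsFirst_right_iff _).2 (Or.inl (Set.eq_empty_of_forall_notMem fun A hA => ?_))
    rw [mem_rightOptions_add, h, rightOptions_leftMoves] at hA
    simp at hA
  · refine winsFirst_right_of_move (mem_rightOptions_add.2 (Or.inl ⟨K', hK', rfl⟩)) ?_
    have := formalBirthday_lt_of_mem_rightOptions hK'
    -- Left still has a move, so she is not stuck; her only reply spends one of the added moves.
    obtain ⟨n, rfl⟩ : ∃ k, n = k + 1 := ⟨n - 1, by omega⟩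
    have hm : leftMoves n ∈ (leftMoves (n + 1)).leftOptions := by
      rw [leftOptions_leftMoves_succ]; rfl
    refine not_winsFirst_left (mem_leftOptions_add.2 (Or.inr ⟨_, hm, rfl⟩)) fun A hA => ?_
    rw [mem_leftOptions_add, (hK.of_mem hK').leftOptions_eq, leftOptions_leftMoves_succ] at hA
    simp only [Set.mem_empty_iff_false, false_and, exists_false, false_or,
      Set.mem_singleton_iff, exists_eq_left] at hA
    subst hA
    exact hR K' hK' (hK.of_mem hK') n (by omega)

/-- If `H ≤ G` fails, this is witnessed by a game in which Right moves first. -/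
theorem exists_right_first_of_not_le {G H : ShortGame} (h : ¬ H ≤ G) :
    ∃ X : ShortGame, (G + X).winsFirst .right ∧ ¬ (H + X).winsFirst .right := by
  obtain ⟨X, hX⟩ := not_forall.1 h
  by_cases h₂ : (G + X).winsFirst .right ∧ ¬ (H + X).winsFirst .right
  · exact ⟨X, h₂⟩
  have h₁ : (H + X).winsFirst .left ∧ ¬ (G + X).winsFirst .left := by
    by_contra h₁
    refine hX ⟨fun a => ?_, fun a b => ?_⟩
    · by_contra c; exact h₁ ⟨a, c⟩
    · exact h₂ ⟨b, a⟩
  -- Now `X` separates the games with Left moving first. In `Y` Right may move to `X`, which wins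
  -- for him next to `G` and loses next to `H`; his moves in `H` lose to Left's reply `Z`.
  set Z := rightMoves (H.formalBirthday + 1)
  set Y := mk 1 1 (fun _ => Z) (fun _ => X)
  have hX : X ∈ Y.rightOptions := ⟨0, rfl⟩
  have hZ : Z ∈ Y.leftOptions := ⟨0, rfl⟩
  refine ⟨Y, winsFirst_right_of_move (mem_rightOptions_add.2 (Or.inr ⟨X, hX, rfl⟩)) h₁.2,
    not_winsFirst_right (mem_rightOptions_add.2 (Or.inr ⟨X, hX, rfl⟩)) fun A hA => ?_⟩
  rcases mem_rightOptions_add.1 hA with ⟨H', hH', rfl⟩ | ⟨B, ⟨_, rfl⟩, rfl⟩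
  · refine winsFirst_left_of_move (mem_leftOptions_add.2 (Or.inr ⟨Z, hZ, rfl⟩)) ?_
    have := formalBirthday_lt_of_mem_rightOptions hH'
    exact (left_wins_add_rightMoves H').2 _ (by omega)
  · exact h₁.1

/-- A Right option of the larger game, if that is a Left dead end, is answered by a smaller
Right option of the smaller game. -/
theorem IsLeftDeadEnd.exists_rightOption_le {G G' H : ShortGame} (hG : G.IsLeftDeadEnd)
    (h : H ≤ G) (hG' : G' ∈ G.rightOptions) : ∃ H' ∈ H.rightOptions, H' ≤ G' := by
  by_contra! hc
  have hd := hG.of_mem hG'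
  set Z := rightMoves H.formalBirthday with hZdef
  set W := leftMoves (G'.formalBirthday + 1)
  -- The Left options of `X` are the witnesses against each `H' ≤ G'`, so Left can answer every
  -- `H'`, but after `G'` each of her moves loses. `W` guarantees her a move there, and `Z`
  -- guarantees Right a move in `H + X`, both needed when `H` has no Right option.
  obtain ⟨X, hXZ, ⟨V, hXV⟩, hXG, hXH⟩ : ∃ X : ShortGame, X.rightOptions = {Z} ∧
      (∃ V, V ∈ X.leftOptions) ∧
      (∀ V ∈ X.leftOptions, (G' + V).winsFirst .right) ∧
      ∀ H' ∈ H.rightOptions, ∃ V ∈ X.leftOptions, ¬ (H' + V).winsFirst .right := by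
    cases H with | mk m n L R =>
    choose V hV₁ hV₂ using fun i : Fin n => exists_right_first_of_not_le (hc (R i) ⟨i, rfl⟩)
    refine ⟨mk (n + 1) 1 (Fin.cons W V) (fun _ => Z), Set.range_const, ⟨W, 0, rfl⟩, ?_, ?_⟩
    · rintro _ ⟨i, rfl⟩
      refine Fin.cases ?_ (fun i => ?_) i
      · exact hd.right_wins_add_leftMoves _ le_rfl
      · exact hV₁ i
    · rintro _ ⟨i, rfl⟩
      exact ⟨V i, ⟨i.succ, rfl⟩, hV₂ i⟩
  refine (h X).2 ?_ (winsFirst_right_of_move (mem_rightOptions_add.2 (Or.inl ⟨G', hG', rfl⟩)) ?_)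
  · have hZ : Z ∈ X.rightOptions := by rw [hXZ]; rfl
    refine not_winsFirst_right (mem_rightOptions_add.2 (Or.inr ⟨Z, hZ, rfl⟩)) fun A hA => ?_
    rcases mem_rightOptions_add.1 hA with ⟨H', hH', rfl⟩ | ⟨B, hB, rfl⟩
    · obtain ⟨V, hV, hw⟩ := hXH H' hH'
      exact winsFirst_left_of_move (mem_leftOptions_add.2 (Or.inr ⟨V, hV, rfl⟩)) hw
    · rw [hXZ, Set.mem_singleton_iff] at hB
      subst hB
      exact (left_wins_add_rightMoves H).1 _ le_rfl
  · refine not_winsFirst_left (mem_leftOptions_add.2 (Or.inr ⟨V, hXV, rfl⟩)) fun A hA => ?_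
    rw [mem_leftOptions_add, hd.leftOptions_eq] at hA
    obtain ⟨_, h, _⟩ | ⟨V, hV, rfl⟩ := hA
    · exact h.elim
    · exact hXG V hV

/-- If `H` had a Right option, `X` would separate the games: Right is stuck in `G + X` and wins, but
must move in `H + X`, whereupon Left plays to `Z`. -/
theorem rightOptions_eq_empty_of_le {G H : ShortGame} (h : H ≤ G) (hG : G.rightOptions = ∅) :
    H.rightOptions = ∅ := by
  refine Set.eq_empty_of_forall_notMem fun H' hH' => ?_
  set Z := rightMoves H.formalBirthday
  set X := mk 1 0 (fun _ => Z) Fin.elim0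
  have hX : X.rightOptions = ∅ := Set.range_eq_empty _
  have hZ : Z ∈ X.leftOptions := ⟨0, rfl⟩
  refine (h X).2 (not_winsFirst_right (mem_rightOptions_add.2 (Or.inl ⟨H', hH', rfl⟩))
    fun A hA => ?_) ?_
  · rw [mem_rightOptions_add, hX] at hA
    obtain ⟨H'', hH'', rfl⟩ | ⟨_, h, _⟩ := hA
    · exact winsFirst_left_of_move (mem_leftOptions_add.2 (Or.inr ⟨Z, hZ, rfl⟩))
        ((left_wins_add_rightMoves H'').2 _ (formalBirthday_lt_of_mem_rightOptions hH''))
    · exact h.elim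
  · refine (winsFirst_right_iff _).2 (Or.inl (Set.eq_empty_of_forall_notMem fun A hA => ?_))
    rw [mem_rightOptions_add, hG, hX] at hA
    simp at hA

/-- The sufficient condition for comparing Left dead ends. -/
theorem IsLeftDeadEnd.le_of_rightOptions {G H : ShortGame} (hG : G.IsLeftDeadEnd)
    (hH : H.IsLeftDeadEnd) (h₀ : G.rightOptions = ∅ → H.rightOptions = ∅)
    (h : ∀ G' ∈ G.rightOptions, ∃ H' ∈ H.rightOptions, H' ≤ G') : H ≤ G := by
  intro X
  induction X using option_induction with | h X hL hR =>
  refine ⟨fun hw => ?_, fun hw hw' => hw ?_⟩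
  · change (G + X).winsFirst .left
    rcases (winsFirst_left_iff _).1 hw with he | ⟨A, hA, hwA⟩
    · refine (winsFirst_left_iff _).2 (Or.inl (Set.eq_empty_of_forall_notMem fun A hA => ?_))
      rw [mem_leftOptions_add, hG.leftOptions_eq] at hA
      obtain ⟨_, h, _⟩ | ⟨V, hV, rfl⟩ := hA
      · exact h
      · exact (Set.eq_empty_iff_forall_notMem.1 he) _
          (mem_leftOptions_add.2 (Or.inr ⟨V, hV, rfl⟩))
    · rw [mem_leftOptions_add, hH.leftOptions_eq] at hA
      obtain ⟨_, h, _⟩ | ⟨V, hV, rfl⟩ := hA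
      · exact h.elim
      · exact winsFirst_left_of_move (mem_leftOptions_add.2 (Or.inr ⟨V, hV, rfl⟩))
          ((hL V hV).2 hwA)
  -- Right's win in `G + X` is carried to `H + X`: `h₀` handles his being stuck, `h` his moves in
  -- `G`.
  · rcases (winsFirst_right_iff _).1 hw' with he | ⟨A, hA, hwA⟩
    · have he' := Set.eq_empty_iff_forall_notMem.1 he
      have hH₀ := h₀ (Set.eq_empty_of_forall_notMem fun B hB =>
        he' _ (mem_rightOptions_add.2 (Or.inl ⟨B, hB, rfl⟩)))
      refine (winsFirst_right_iff _).2 (Or.inl (Set.eq_empty_of_forall_notMem fun A hA => ?_))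
      rw [mem_rightOptions_add, hH₀] at hA
      obtain ⟨_, h, _⟩ | ⟨V, hV, rfl⟩ := hA
      · exact h
      · exact he' _ (mem_rightOptions_add.2 (Or.inr ⟨V, hV, rfl⟩))
    · rcases mem_rightOptions_add.1 hA with ⟨G', hG', rfl⟩ | ⟨V, hV, rfl⟩
      · obtain ⟨H', hH', hle⟩ := h G' hG'
        exact winsFirst_right_of_move (mem_rightOptions_add.2 (Or.inl ⟨H', hH', rfl⟩))
          fun c => hwA ((hle X).1 c)
      · exact winsFirst_right_of_move (mem_rightOptions_add.2 (Or.inr ⟨V, hV, rfl⟩))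
          fun c => hwA ((hR V hV).1 c)

theorem add_le_add_left' {G H : ShortGame} (h : G ≤ H) (K : ShortGame) : K + G ≤ K + H :=
  (iso_add_comm K G).misereEq.1.trans
    ((add_le_add_right' h K).trans (iso_add_comm H K).misereEq.1)

/-! ### Race -/

theorem terminalLengths_nonempty (G : ShortGame) : G.terminalLengths.Nonempty := by
  induction G using option_induction with | h G hL hR =>
  rcases G.options.eq_empty_or_nonempty with h | ⟨G', hG'⟩
  · exact ⟨0, .zero h⟩
  · obtain ⟨n, hn⟩ := hG'.elim (hL G') (hR G')
    exact ⟨n + 1, .succ hG' hn⟩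

theorem hasTerminalRun_race (G : ShortGame) : HasTerminalRun G G.race :=
  Nat.sInf_mem G.terminalLengths_nonempty

theorem race_le_of_mem_options {G G' : ShortGame} (h : G' ∈ G.options) :
    G.race ≤ G'.race + 1 :=
  Nat.sInf_le (.succ h (hasTerminalRun_race G'))

theorem race_of_options_eq_empty {G : ShortGame} (h : G.options = ∅) : G.race = 0 :=
  Nat.le_zero.1 (Nat.sInf_le (.zero h))

theorem exists_race_of_options_nonempty {G : ShortGame} (h : G.options.Nonempty) :
    ∃ G' ∈ G.options, G'.race + 1 = G.race := by
  have hr := hasTerminalRun_race G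
  generalize hn : G.race = n at hr
  cases hr with
  | zero h' => exact absurd h' h.ne_empty
  | @succ _ G' n h₁ h₂ =>
    have h₃ : G'.race ≤ n := Nat.sInf_le h₂
    have h₄ := race_le_of_mem_options h₁
    exact ⟨G', h₁, by omega⟩

/-- A shortest run of `G` is shadowed option by option in `H`, which ends no later. -/
theorem IsLeftDeadEnd.race_le_race {G H : ShortGame} (hG : G.IsLeftDeadEnd)
    (hH : H.IsLeftDeadEnd) (h : H ≤ G) : H.race ≤ G.race := by
  induction G using option_induction generalizing H with | h G hL hR =>
  rcases G.options.eq_empty_or_nonempty with h₀ | h₀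
  · rw [race_of_options_eq_empty]
    · exact Nat.zero_le _
    · rw [hH.options_eq]
      rw [hG.options_eq] at h₀
      exact rightOptions_eq_empty_of_le h h₀
  · obtain ⟨G', hG', hr⟩ := exists_race_of_options_nonempty h₀
    rw [hG.options_eq] at hG'
    obtain ⟨H', hH', hle⟩ := hG.exists_rightOption_le h hG'
    have h₁ := hR G' hG' (hG.of_mem hG') (hH.of_mem hH') hle
    have h₂ := race_le_of_mem_options (G := H) (Or.inr hH')
    omega

theorem mem_options_add {G H K : ShortGame} :
    K ∈ (G + H).options ↔
      (∃ G' ∈ G.options, K = G' + H) ∨ (∃ H' ∈ H.options, K = G + H') := by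
  simp only [options, Set.mem_union, mem_leftOptions_add, mem_rightOptions_add]
  grind

theorem race_add (G H : ShortGame) : (G + H).race = G.race + H.race := by
  induction G using option_induction generalizing H with | h G hL hR =>
  induction H using option_induction with | h H kL kR =>
  have hG : ∀ G' ∈ G.options, (G' + H).race = G'.race + H.race :=
    fun G' h => h.elim (fun h => hL G' h H) (fun h => hR G' h H)
  have hH : ∀ H' ∈ H.options, (G + H').race = G.race + H'.race :=
    fun H' h => h.elim (kL H') (kR H')
  apply le_antisymm
  · rcases G.options.eq_empty_or_nonempty with h₀ | h₀
    · rcases H.options.eq_empty_or_nonempty with h₁ | h₁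
      · rw [race_of_options_eq_empty (G := G + H)]
        · exact Nat.zero_le _
        · refine Set.eq_empty_of_forall_notMem fun K hK => ?_
          rw [mem_options_add, h₀, h₁] at hK
          simp at hK
      · obtain ⟨H', hH', hr⟩ := exists_race_of_options_nonempty h₁
        have := race_le_of_mem_options (mem_options_add (G := G).2 (Or.inr ⟨H', hH', rfl⟩))
        rw [hH H' hH'] at this
        omega
    · obtain ⟨G', hG', hr⟩ := exists_race_of_options_nonempty h₀
      have := race_le_of_mem_options (mem_options_add (H := H).2 (Or.inl ⟨G', hG', rfl⟩))
      rw [hG G' hG'] at this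
      omega
  · rcases (G + H).options.eq_empty_or_nonempty with h₀ | h₀
    · rw [race_of_options_eq_empty (G := G), race_of_options_eq_empty (G := H)]
      · exact Nat.zero_le _
      · refine Set.eq_empty_of_forall_notMem fun K hK => ?_
        exact Set.eq_empty_iff_forall_notMem.1 h₀ _ (mem_options_add.2 (Or.inr ⟨K, hK, rfl⟩))
      · refine Set.eq_empty_of_forall_notMem fun K hK => ?_
        exact Set.eq_empty_iff_forall_notMem.1 h₀ _ (mem_options_add.2 (Or.inl ⟨K, hK, rfl⟩))
    · obtain ⟨K, hK, hr⟩ := exists_race_of_options_nonempty h₀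
      rcases mem_options_add.1 hK with ⟨G', hG', rfl⟩ | ⟨H', hH', rfl⟩
      · have := race_le_of_mem_options hG'
        rw [hG G' hG'] at hr
        omega
      · have := race_le_of_mem_options hH'
        rw [hH H' hH'] at hr
        omega

/-! ### Birthday -/

theorem formalBirthday_lt_of_mem_options {G G' : ShortGame} (h : G' ∈ G.options) :
    G'.formalBirthday < G.formalBirthday :=
  h.elim formalBirthday_lt_of_mem_leftOptions formalBirthday_lt_of_mem_rightOptions

theorem formalBirthday_le {G : ShortGame} {n : ℕ}
    (h : ∀ G' ∈ G.options, G'.formalBirthday < n) : G.formalBirthday ≤ n := by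
  cases G with | mk a b L R =>
  exact max_le (Finset.sup_le fun i _ => h _ (Or.inl ⟨i, rfl⟩))
    (Finset.sup_le fun i _ => h _ (Or.inr ⟨i, rfl⟩))

theorem exists_formalBirthday_of_options_nonempty {G : ShortGame} (h : G.options.Nonempty) :
    ∃ G' ∈ G.options, G'.formalBirthday + 1 = G.formalBirthday := by
  by_contra! hc
  obtain ⟨G', hG'⟩ := h
  have h₀ := formalBirthday_lt_of_mem_options hG'
  have := formalBirthday_le (G := G) (n := G.formalBirthday - 1) fun K hK => by
    have h₁ := formalBirthday_lt_of_mem_options hK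
    have h₂ := hc K hK
    omega
  omega

/-- A longest run of `G` is shadowed in `H`. Since `H` is arbitrary, no equal form, dead end or not,
can have a smaller tree than `G`. -/
theorem IsLeftDeadEnd.formalBirthday_le_formalBirthday {G H : ShortGame}
    (hG : G.IsLeftDeadEnd) (h : H ≤ G) : G.formalBirthday ≤ H.formalBirthday := by
  induction G using option_induction generalizing H with | h G hL hR =>
  refine formalBirthday_le fun G' hG' => ?_
  rw [hG.options_eq] at hG'
  obtain ⟨H', hH', hle⟩ := hG.exists_rightOption_le h hG'
  exact (hR G' hG' (hG.of_mem hG') hle).trans_lt (formalBirthday_lt_of_mem_rightOptions hH')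

theorem IsLeftDeadEnd.birthday_eq {G : ShortGame} (hG : G.IsLeftDeadEnd) :
    G.birthday = G.formalBirthday := by
  apply le_antisymm
  · exact Nat.sInf_le ⟨G, AntisymmRel.refl _ _, rfl⟩
  · refine le_csInf ⟨_, G, AntisymmRel.refl _ _, rfl⟩ ?_
    rintro _ ⟨H, hH, rfl⟩
    exact hG.formalBirthday_le_formalBirthday hH.2

theorem formalBirthday_add (G H : ShortGame) :
    (G + H).formalBirthday = G.formalBirthday + H.formalBirthday := by
  induction G using option_induction generalizing H with | h G hL hR =>
  induction H using option_induction with | h H kL kR =>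
  have hG : ∀ G' ∈ G.options, (G' + H).formalBirthday = G'.formalBirthday + H.formalBirthday :=
    fun G' h => h.elim (fun h => hL G' h H) (fun h => hR G' h H)
  have hH : ∀ H' ∈ H.options, (G + H').formalBirthday = G.formalBirthday + H'.formalBirthday :=
    fun H' h => h.elim (kL H') (kR H')
  apply le_antisymm
  · refine formalBirthday_le fun K hK => ?_
    rcases mem_options_add.1 hK with ⟨G', hG', rfl⟩ | ⟨H', hH', rfl⟩
    · have := formalBirthday_lt_of_mem_options hG'
      rw [hG G' hG']
      omega
    · have := formalBirthday_lt_of_mem_options hH'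
      rw [hH H' hH']
      omega
  · rcases G.options.eq_empty_or_nonempty with h₀ | h₀
    · have hz : G.formalBirthday ≤ 0 := formalBirthday_le fun G' hG' => by
        rw [h₀] at hG'; exact hG'.elim
      rcases H.options.eq_empty_or_nonempty with h₁ | h₁
      · have hz' : H.formalBirthday ≤ 0 := formalBirthday_le fun G' hG' => by
          rw [h₁] at hG'; exact hG'.elim
        omega
      · obtain ⟨H', hH', hr⟩ := exists_formalBirthday_of_options_nonempty h₁
        have := formalBirthday_lt_of_mem_options
          (mem_options_add (G := G).2 (Or.inr ⟨H', hH', rfl⟩))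
        rw [hH H' hH'] at this
        omega
    · obtain ⟨G', hG', hr⟩ := exists_formalBirthday_of_options_nonempty h₀
      have := formalBirthday_lt_of_mem_options
        (mem_options_add (H := H).2 (Or.inl ⟨G', hG', rfl⟩))
      rw [hG G' hG'] at this
      omega

/-! ### Cancellation -/

/-- The option `A + C'` of `A + C` is answered in `B + C'`. An answer in `B` finishes with `K = C'`;
an answer `C''` gives `B + C'' ≤ A + C'`, the same situation one level deeper, and `C` is finite. -/
theorem exists_add_le_add_of_mem_rightOptions {A B : ShortGame} (hA : A.IsLeftDeadEnd)
    {C : ShortGame} (hC : C.IsLeftDeadEnd) :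
    ∀ C' ∈ C.rightOptions, B + C' ≤ A + C →
      ∃ B' ∈ B.rightOptions, ∃ K : ShortGame, K.IsLeftDeadEnd ∧ B' + K ≤ A + K := by
  induction C using option_induction with | h C hL hR =>
  intro C' hC' h
  obtain ⟨D, hD, hle⟩ := (hA.add hC).exists_rightOption_le h
    (mem_rightOptions_add.2 (Or.inr ⟨C', hC', rfl⟩))
  rcases mem_rightOptions_add.1 hD with ⟨B', hB', rfl⟩ | ⟨C'', hC'', rfl⟩
  · exact ⟨B', hB', C', hC.of_mem hC', hle⟩
  · exact hR C' hC' (hC.of_mem hC') C'' hC'' hle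

/-- Induction on `A` for all `C` at once, because an answer to `A' + C` made inside `C` yields an
inequality with a different summand `K`. If `A` has no options, comparing races forces the same for
`B`. -/
theorem IsLeftDeadEnd.le_of_add_le_add_right {A B C : ShortGame} (hA : A.IsLeftDeadEnd)
    (hB : B.IsLeftDeadEnd) (hC : C.IsLeftDeadEnd) (h : B + C ≤ A + C) : B ≤ A := by
  induction A using option_induction generalizing B C with | h A hL hR =>
  refine hA.le_of_rightOptions hB (fun h₀ => ?_) fun A' hA' => ?_
  · have hr := (hA.add hC).race_le_race (hB.add hC) h
    rw [← hA.options_eq] at h₀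
    rw [race_add, race_add, race_of_options_eq_empty h₀] at hr
    by_contra hne
    rw [← hB.options_eq] at hne
    obtain ⟨B', -, hB'⟩ := exists_race_of_options_nonempty (Set.nonempty_iff_ne_empty.2 hne)
    omega
  · have hA'd := hA.of_mem hA'
    obtain ⟨D, hD, hle⟩ := (hA.add hC).exists_rightOption_le h
      (mem_rightOptions_add.2 (Or.inl ⟨A', hA', rfl⟩))
    rcases mem_rightOptions_add.1 hD with ⟨B', hB', rfl⟩ | ⟨C', hC', rfl⟩
    · exact ⟨B', hB', hR A' hA' hA'd (hB.of_mem hB') hC hle⟩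
    · obtain ⟨B', hB', K, hK, hle'⟩ :=
        exists_add_le_add_of_mem_rightOptions hA'd hC C' hC' hle
      exact ⟨B', hB', hR A' hA' hA'd (hB.of_mem hB') hK hle'⟩

theorem IsLeftDeadEnd.le_of_add_le_add_left {A B C : ShortGame} (hA : A.IsLeftDeadEnd)
    (hB : B.IsLeftDeadEnd) (hC : C.IsLeftDeadEnd) (h : C + B ≤ C + A) : B ≤ A :=
  hA.le_of_add_le_add_right hB hC ((iso_add_comm B C).misereEq.1.trans
    (h.trans (iso_add_comm C A).misereEq.1))

end ShortGame

/-! ### Unique factorisation in reduced cancellative monoids -/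

section UniqueFactorisation

variable {M : Type*} [AddCommMonoid M] [Subsingleton (AddUnits M)]

theorem AddIrreducible.eq_of_isAddPrime_of_dvd {p a c : M} (hp : IsAddPrime p)
    (ha : AddIrreducible a) (h : p + c = a) : p = a := by
  rcases ha.isAddUnit_or_isAddUnit h.symm with h' | h'
  · exact absurd h' hp.1
  · rw [isAddUnit_iff_eq_zero] at h'
    rw [← h, h', add_zero]

theorem IsAddPrime.mem_of_dvd_sum {p : M} (hp : IsAddPrime p) (s : Multiset M) :
    (∀ a ∈ s, AddIrreducible a) → ∀ c, p + c = s.sum → p ∈ s := by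
  induction s using Multiset.induction with
  | empty =>
    intro _ c h
    exact absurd (IsAddUnit.of_add_eq_zero (a := p) c (by simpa using h)) hp.1
  | cons a s ih =>
    intro hs c h
    rw [Multiset.sum_cons] at h
    rcases hp.2 _ _ ⟨c, h⟩ with ⟨d, hd⟩ | ⟨d, hd⟩
    · rw [(hs a (Multiset.mem_cons_self a s)).eq_of_isAddPrime_of_dvd hp hd]
      exact Multiset.mem_cons_self a s
    · exact Multiset.mem_cons_of_mem (ih (fun b hb => hs b (Multiset.mem_cons_of_mem hb)) d hd)

variable [IsCancelAdd M]

/-- Primes can be cancelled from a factorisation. -/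
theorem eq_add_of_sum_eq_of_isAddPrime {s : Multiset M}
    (hs : ∀ t : Multiset M, (∀ b ∈ t, AddIrreducible b) → t.sum = s.sum → t = s)
    (p : Multiset M) : (∀ q ∈ p, IsAddPrime q) →
    ∀ t : Multiset M, (∀ b ∈ t, AddIrreducible b) → t.sum = (p + s).sum → t = p + s := by
  induction p using Multiset.induction with
  | empty => simpa using hs
  | cons q p ih =>
    intro hp t ht h
    have hq := (hp q (Multiset.mem_cons_self q p)).mem_of_dvd_sum t ht (p + s).sum (by
      rw [h, Multiset.cons_add, Multiset.sum_cons])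
    obtain ⟨t, rfl⟩ := Multiset.exists_cons_of_mem hq
    rw [Multiset.cons_add, Multiset.sum_cons, Multiset.sum_cons] at h
    rw [Multiset.cons_add, ih (fun r hr => hp r (Multiset.mem_cons_of_mem hr)) t
      (fun b hb => ht b (Multiset.mem_cons_of_mem hb)) (add_left_cancel h)]

/-- Let `r` be a relation with respect to which every nonzero element has a step, and every step
from a sum is a step in one of the summands. Then sums of atoms all of whose steps are
prime-factorisable have only one factorisation. -/
theorem eq_of_sum_eq_of_steps {r : M → M → Prop}
    (hfac : ∀ x : M, ∃ s, IsFactorisation s x)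
    (hex : ∀ x : M, x ≠ 0 → ∃ x', r x' x)
    (hsum : ∀ (s : Multiset M) (x' : M), r x' s.sum →
      ∃ a u, s = a ::ₘ u ∧ ∃ a', r a' a ∧ x' = a' + u.sum)
    (s : Multiset M) :
    (∀ a ∈ s, AddIrreducible a ∧ ∀ a', r a' a → IsPrimeFactorisable a') →
    ∀ t : Multiset M, (∀ b ∈ t, AddIrreducible b) → t.sum = s.sum → t = s := by
  induction s using Multiset.strongInductionOn with | ih s ih =>
  intro hs t ht h
  by_cases hc : ∃ c ∈ s, c ∈ t
  · obtain ⟨c, hcs, hct⟩ := hc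
    obtain ⟨s, rfl⟩ := Multiset.exists_cons_of_mem hcs
    obtain ⟨t, rfl⟩ := Multiset.exists_cons_of_mem hct
    rw [Multiset.sum_cons, Multiset.sum_cons] at h
    rw [ih s (Multiset.lt_cons_self s c) (fun a ha => hs a (Multiset.mem_cons_of_mem ha)) t
      (fun b hb => ht b (Multiset.mem_cons_of_mem hb)) (add_left_cancel h)]
  by_cases h₀ : s.sum = 0
  · have key : ∀ u : Multiset M, (∀ a ∈ u, AddIrreducible a) → u.sum = 0 → u = 0 := by
      intro u hu hu₀
      refine Multiset.eq_zero_of_forall_notMem fun a ha => (hu a ha).not_isAddUnit ?_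
      obtain ⟨v, rfl⟩ := Multiset.exists_cons_of_mem ha
      exact IsAddUnit.of_add_eq_zero v.sum (by rwa [Multiset.sum_cons] at hu₀)
    rw [key t ht (h.trans h₀), key s (fun a ha => (hs a ha).1) h₀]
  exfalso
  -- With no common atom, a single step of the common sum is read in both factorisations.
  obtain ⟨x', hx'⟩ := hex _ h₀
  obtain ⟨a, u, rfl, a', ha', hx⟩ := hsum s x' hx'
  rw [← h] at hx'
  obtain ⟨b, v, rfl, b', -, hx₂⟩ := hsum t x' hx'
  obtain ⟨p, ⟨-, hpsum⟩, hprime⟩ := (hs a (Multiset.mem_cons_self a u)).2 a' ha'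
  obtain ⟨q, hq, hqsum⟩ := hfac b'
  -- If `b` is all of `t`, then the atom `b` is `a + u.sum`, so `a = b` is common.
  rcases v.empty_or_exists_mem with rfl | ⟨c, hcv⟩
  · rw [Multiset.sum_cons, Multiset.sum_cons, Multiset.sum_zero, add_zero] at h
    rcases (ht b (Multiset.mem_cons_self b 0)).isAddUnit_or_isAddUnit h with h' | h'
    · exact (hs a (Multiset.mem_cons_self a u)).1.not_isAddUnit h'
    · rw [isAddUnit_iff_eq_zero] at h'
      rw [h', add_zero] at h
      exact hc ⟨a, Multiset.mem_cons_self a u, h ▸ Multiset.mem_cons_self b 0⟩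
  · have hct : c ∈ b ::ₘ v := Multiset.mem_cons_of_mem hcv
    -- Both sides factorise `x'`: the primes `p` cancel, and `u` is covered by induction.
    have heq : q + v = p + u := by
      refine eq_add_of_sum_eq_of_isAddPrime (ih u (Multiset.lt_cons_self u a)
        fun d hd => hs d (Multiset.mem_cons_of_mem hd)) p hprime _ (fun d hd => ?_) ?_
      · exact (Multiset.mem_add.1 hd).elim (hq d) fun h => ht d (Multiset.mem_cons_of_mem h)
      · rw [Multiset.sum_add, Multiset.sum_add, hpsum, hqsum, ← hx, ← hx₂]
    rcases Multiset.mem_add.1 (heq ▸ Multiset.mem_add.2 (Or.inr hcv) : c ∈ p + u) with hcp | hcu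
    · obtain ⟨w, hw⟩ := Multiset.exists_cons_of_mem hct
      refine hc ⟨c, (hprime c hcp).mem_of_dvd_sum _ (fun d hd => (hs d hd).1) w.sum ?_, hct⟩
      rw [← h, hw, Multiset.sum_cons]
    · exact hc ⟨c, Multiset.mem_cons_of_mem hcu, hct⟩

end UniqueFactorisation

/-! ### Good options lowering race or birthday -/

namespace ShortGame

/-- An additive invariant of Left dead ends such that some option of a nonempty game lowers it by
one, and such that options below an option of this kind are of this kind as well. -/
structure IsOptionRank (ρ : ShortGame → ℕ) : Prop where
  add : ∀ {G H : ShortGame}, G.IsLeftDeadEnd → H.IsLeftDeadEnd → ρ (G + H) = ρ G + ρ H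
  congr : ∀ {G H : ShortGame}, G.IsLeftDeadEnd → H.IsLeftDeadEnd → MisereEq G H → ρ G = ρ H
  exists_option : ∀ {G : ShortGame}, G.IsLeftDeadEnd → G.rightOptions.Nonempty →
    ∃ G' ∈ G.rightOptions, ρ G' + 1 = ρ G
  of_le : ∀ {G G' G'' : ShortGame}, G.IsLeftDeadEnd → G' ∈ G.rightOptions →
    G'' ∈ G.rightOptions → G'' ≤ G' → ρ G' + 1 = ρ G → ρ G'' + 1 = ρ G

/-- For `of_le`: a smaller option has no larger race, and no option lowers the race by more than
one. -/
theorem isOptionRank_race : IsOptionRank race where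
  add _ _ := race_add _ _
  congr hG hH h := le_antisymm (hH.race_le_race hG h.1) (hG.race_le_race hH h.2)
  exists_option hG h := by
    rw [← hG.options_eq] at h ⊢
    exact exists_race_of_options_nonempty h
  of_le hG hG' hG'' hle h := by
    have h₁ := (hG.of_mem hG').race_le_race (hG.of_mem hG'') hle
    have h₂ := race_le_of_mem_options (Or.inr hG'')
    omega

/-- For `of_le` the bounds are reversed: a smaller option has no smaller birthday, and every option
lowers it by at least one. -/
theorem isOptionRank_birthday : IsOptionRank birthday where
  add hG hH := by
    rw [(hG.add hH).birthday_eq, hG.birthday_eq, hH.birthday_eq, formalBirthday_add]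
  congr hG hH h := by
    rw [hG.birthday_eq, hH.birthday_eq]
    exact le_antisymm (hG.formalBirthday_le_formalBirthday h.2)
      (hH.formalBirthday_le_formalBirthday h.1)
  exists_option hG h := by
    rw [← hG.options_eq] at h
    obtain ⟨G', hG', hb⟩ := exists_formalBirthday_of_options_nonempty h
    rw [hG.options_eq] at hG'
    exact ⟨G', hG', by rw [hG.birthday_eq, (hG.of_mem hG').birthday_eq, hb]⟩
  of_le hG hG' hG'' hle h := by
    rw [hG.birthday_eq, (hG.of_mem hG').birthday_eq] at h
    rw [hG.birthday_eq, (hG.of_mem hG'').birthday_eq]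
    have h₁ := (hG.of_mem hG').formalBirthday_le_formalBirthday hle
    have h₂ := formalBirthday_lt_of_mem_rightOptions hG''
    omega

theorem IsLeftDeadEnd.isGoodOption_iff {G G' : ShortGame} (hG : G.IsLeftDeadEnd) :
    IsGoodOption G' G ↔ G' ∈ G.rightOptions ∧ ∀ G'' ∈ G.rightOptions, ¬ G'' < G' := by
  simp [IsGoodOption, hG.leftOptions_eq]

theorem IsLeftDeadEnd.misereEq_zero {G : ShortGame} (hG : G.IsLeftDeadEnd)
    (h : G.rightOptions = ∅) : MisereEq G 0 := by
  have h₀ : (0 : ShortGame).rightOptions = ∅ :=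
    Set.eq_empty_of_forall_notMem fun _ => not_mem_rightOptions_zero
  constructor
  · exact isLeftDeadEnd_zero.le_of_rightOptions hG (fun _ => h) (by simp [h₀])
  · exact hG.le_of_rightOptions isLeftDeadEnd_zero (fun _ => h₀) (by simp [h])

/-- Equal Left dead ends have equal good options. -/
theorem IsGoodOption.exists_misereEq {G H G' : ShortGame} (hG : G.IsLeftDeadEnd)
    (hH : H.IsLeftDeadEnd) (h : MisereEq G H) (hG' : IsGoodOption G' G) :
    ∃ H', IsGoodOption H' H ∧ MisereEq G' H' := by
  obtain ⟨hm, hgood⟩ := hG.isGoodOption_iff.1 hG'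
  obtain ⟨H', hH', hle⟩ := hG.exists_rightOption_le h.2 hm
  -- An option of `H` below `G'` is in turn above some option of `G`; as `G'` is good, all three are
  -- equal.
  have key : ∀ K ∈ H.rightOptions, K ≤ G' → G' ≤ K := by
    intro K hK hKG
    obtain ⟨G'', hG'', hle'⟩ := hH.exists_rightOption_le h.1 hK
    by_contra hn
    exact hgood G'' hG'' ⟨hle'.trans hKG, fun c => hn (le_trans c hle')⟩
  refine ⟨H', hH.isGoodOption_iff.2 ⟨hH', fun K hK hlt => ?_⟩, key H' hH' hle, hle⟩
  exact hlt.not_ge (hle.trans (key K hK (hlt.le.trans hle)))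

theorem IsOptionRank.exists_isGoodOption {ρ : ShortGame → ℕ} (hρ : IsOptionRank ρ)
    {G : ShortGame} (hG : G.IsLeftDeadEnd) (h : G.rightOptions.Nonempty) :
    ∃ G', IsGoodOption G' G ∧ ρ G' + 1 = ρ G := by
  obtain ⟨G', hG', hr⟩ := hρ.exists_option hG h
  -- A minimal option below `G'` is good, and `of_le` preserves the drop in rank.
  obtain ⟨K, hle, hK, hmin⟩ := G.finite_rightOptions.exists_le_minimal hG'
  exact ⟨K, hG.isGoodOption_iff.2 ⟨hK, fun A hA hlt => hlt.not_ge (hmin hA hlt.le)⟩,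
    hρ.of_le hG hG' hK hle hr⟩

/-- By cancellation, strict domination in `G` stays strict after adding `H`. -/
theorem IsGoodOption.of_add_right {G G' H : ShortGame} (hG : G.IsLeftDeadEnd)
    (hH : H.IsLeftDeadEnd) (hG' : G' ∈ G.rightOptions) (h : IsGoodOption (G' + H) (G + H)) :
    IsGoodOption G' G := by
  refine hG.isGoodOption_iff.2 ⟨hG', fun K hK hlt => ?_⟩
  refine ((hG.add hH).isGoodOption_iff.1 h).2 _ (mem_rightOptions_add.2 (Or.inl ⟨K, hK, rfl⟩))
    ⟨add_le_add_right' hlt.le H, fun c => hlt.not_ge ?_⟩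
  exact (hG.of_mem hK).le_of_add_le_add_right (hG.of_mem hG') hH c

theorem IsGoodOption.of_add_left {G H H' : ShortGame} (hG : G.IsLeftDeadEnd)
    (hH : H.IsLeftDeadEnd) (hH' : H' ∈ H.rightOptions) (h : IsGoodOption (G + H') (G + H)) :
    IsGoodOption H' H := by
  refine hH.isGoodOption_iff.2 ⟨hH', fun K hK hlt => ?_⟩
  refine ((hG.add hH).isGoodOption_iff.1 h).2 _ (mem_rightOptions_add.2 (Or.inr ⟨K, hK, rfl⟩))
    ⟨add_le_add_left' hlt.le G, fun c => hlt.not_ge ?_⟩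
  exact (hH.of_mem hK).le_of_add_le_add_left (hH.of_mem hH') hG c

end ShortGame

/-! ### The monoid of values and its good steps -/

namespace LeftDeadEndMonoid

open ShortGame

theorem exists_value_eq (x : LeftDeadEndMonoid) : ∃ G : LeftDeadEnd, G.value = x :=
  Quotient.exists_rep x

theorem value_eq_zero_iff {G : LeftDeadEnd} : G.value = 0 ↔ G.1.rightOptions = ∅ := by
  change G.value = LeftDeadEnd.value ⟨0, isLeftDeadEnd_zero⟩ ↔ _
  rw [LeftDeadEnd.value_eq_value_iff]
  exact ⟨fun h => rightOptions_eq_empty_of_le h.1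
    (Set.eq_empty_of_forall_notMem fun _ => not_mem_rightOptions_zero), G.2.misereEq_zero⟩

instance : IsLeftCancelAdd LeftDeadEndMonoid where
  add_left_cancel := by
    intro a b c h
    obtain ⟨A, rfl⟩ := exists_value_eq a
    obtain ⟨B, rfl⟩ := exists_value_eq b
    obtain ⟨C, rfl⟩ := exists_value_eq c
    have h := LeftDeadEnd.value_eq_value_iff.1 h
    exact LeftDeadEnd.value_eq_value_iff.2 ⟨C.2.le_of_add_le_add_left B.2 A.2 h.1,
      B.2.le_of_add_le_add_left C.2 A.2 h.2⟩

instance : IsCancelAdd LeftDeadEndMonoid := AddCommMagma.IsLeftCancelAdd.toIsCancelAdd _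

theorem eq_zero_of_add_eq_zero {x y : LeftDeadEndMonoid} (h : x + y = 0) : x = 0 := by
  obtain ⟨G, rfl⟩ := exists_value_eq x
  obtain ⟨H, rfl⟩ := exists_value_eq y
  rw [← LeftDeadEnd.value_add, value_eq_zero_iff] at h
  rw [value_eq_zero_iff]
  exact Set.eq_empty_of_forall_notMem fun K hK => Set.eq_empty_iff_forall_notMem.1 h _
    (mem_rightOptions_add.2 (Or.inl ⟨K, hK, rfl⟩))

instance : Subsingleton (AddUnits LeftDeadEndMonoid) :=
  ⟨fun u v => AddUnits.ext ((eq_zero_of_add_eq_zero u.add_neg).trans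
    (eq_zero_of_add_eq_zero v.add_neg).symm)⟩

/-- Every Left dead end has a factorisation. -/
theorem exists_isFactorisation (x : LeftDeadEndMonoid) : ∃ s, IsFactorisation s x := by
  obtain ⟨G, rfl⟩ := exists_value_eq x
  induction hn : G.1.race using Nat.strong_induction_on generalizing G with | h n ih =>
  by_cases h₀ : G.value = 0
  · exact ⟨0, by simp, by rw [h₀, Multiset.sum_zero]⟩
  by_cases hi : AddIrreducible G.value
  · exact ⟨{G.value}, by simpa using hi, Multiset.sum_singleton _⟩
  rw [addIrreducible_iff, isAddUnit_iff_eq_zero] at hi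
  push Not at hi
  obtain ⟨a, b, hab, ha, hb⟩ := hi h₀
  rw [isAddUnit_iff_eq_zero] at ha hb
  obtain ⟨A, rfl⟩ := exists_value_eq a
  obtain ⟨B, rfl⟩ := exists_value_eq b
  -- Race is additive and positive on nonzero values, so both summands have smaller race.
  have pos : ∀ K : LeftDeadEnd, K.value ≠ 0 → 0 < K.1.race := by
    intro K hK
    rw [Ne, value_eq_zero_iff, ← Ne, ← Set.nonempty_iff_ne_empty] at hK
    obtain ⟨K', -, hr⟩ := isOptionRank_race.exists_option K.2 hK
    omega
  have hpA := pos A ha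
  have hpB := pos B hb
  have hr : G.1.race = A.1.race + B.1.race := by
    rw [← race_add]
    exact isOptionRank_race.congr G.2 (A.2.add B.2) (LeftDeadEnd.value_eq_value_iff.1 hab)
  obtain ⟨s, hs, hs'⟩ := ih _ (by omega) A rfl
  obtain ⟨t, ht, ht'⟩ := ih _ (by omega) B rfl
  refine ⟨s + t, fun c hc => (Multiset.mem_add.1 hc).elim (hs c) (ht c), ?_⟩
  rw [Multiset.sum_add, hs', ht', hab]

/-- `x'` is the value of a good option of a form of `x` that lowers `ρ` by one. -/
def IsGoodStep (ρ : ShortGame → ℕ) (x' x : LeftDeadEndMonoid) : Prop :=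
  ∃ G G' : LeftDeadEnd, G.value = x ∧ G'.value = x' ∧ IsGoodOption G'.1 G.1 ∧
    ρ G'.1 + 1 = ρ G.1

variable {ρ : ShortGame → ℕ}

/-- Good steps do not depend on the form. -/
theorem IsGoodStep.exists_option (hρ : IsOptionRank ρ) {x' : LeftDeadEndMonoid}
    {H : LeftDeadEnd} (h : IsGoodStep ρ x' H.value) :
    ∃ H' : LeftDeadEnd, H'.value = x' ∧ H'.1 ∈ H.1.rightOptions ∧ IsGoodOption H'.1 H.1 ∧
      ρ H'.1 + 1 = ρ H.1 := by
  obtain ⟨G, G', hG, rfl, hgood, hr⟩ := h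
  have hGH := LeftDeadEnd.value_eq_value_iff.1 hG
  obtain ⟨H', hH', he⟩ := hgood.exists_misereEq G.2 H.2 hGH
  have hm := (H.2.isGoodOption_iff.1 hH').1
  have hd := H.2.of_mem hm
  refine ⟨⟨H', hd⟩, (LeftDeadEnd.value_eq_value_iff.2 he).symm, hm, hH', ?_⟩
  rw [← hρ.congr G.2 H.2 hGH, ← hρ.congr G'.2 hd he, hr]

theorem exists_isGoodStep (hρ : IsOptionRank ρ) (x : LeftDeadEndMonoid) (hx : x ≠ 0) :
    ∃ x', IsGoodStep ρ x' x := by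
  obtain ⟨G, rfl⟩ := exists_value_eq x
  rw [Ne, value_eq_zero_iff, ← Ne, ← Set.nonempty_iff_ne_empty] at hx
  obtain ⟨G', hG', hr⟩ := hρ.exists_isGoodOption G.2 hx
  exact ⟨_, G, ⟨G', G.2.of_mem (G.2.isGoodOption_iff.1 hG').1⟩, rfl, rfl, hG', hr⟩

/-- An option of `G + H` moves in one component; additivity of `ρ` assigns the drop to it, and
cancellation makes the move good there. -/
theorem IsGoodStep.add (hρ : IsOptionRank ρ) {x y z : LeftDeadEndMonoid}
    (h : IsGoodStep ρ z (x + y)) :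
    (∃ x', IsGoodStep ρ x' x ∧ z = x' + y) ∨ ∃ y', IsGoodStep ρ y' y ∧ z = x + y' := by
  obtain ⟨G, rfl⟩ := exists_value_eq x
  obtain ⟨H, rfl⟩ := exists_value_eq y
  rw [← LeftDeadEnd.value_add] at h
  obtain ⟨⟨K, hKd⟩, rfl, hK, hgood, hr⟩ := h.exists_option hρ
  dsimp only at hK hgood hr
  rw [hρ.add G.2 H.2] at hr
  rcases mem_rightOptions_add.1 hK with ⟨G', hG', rfl⟩ | ⟨H', hH', rfl⟩
  · have hd := G.2.of_mem hG'
    rw [hρ.add hd H.2] at hr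
    exact Or.inl ⟨_, ⟨G, ⟨G', hd⟩, rfl, rfl, hgood.of_add_right G.2 H.2 hG', by
      dsimp only; omega⟩, rfl⟩
  · have hd := H.2.of_mem hH'
    rw [hρ.add G.2 hd] at hr
    exact Or.inr ⟨_, ⟨H, ⟨H', hd⟩, rfl, rfl, hgood.of_add_left G.2 H.2 hH', by
      dsimp only; omega⟩, rfl⟩

theorem not_isGoodStep_zero (hρ : IsOptionRank ρ) (x' : LeftDeadEndMonoid) :
    ¬ IsGoodStep ρ x' 0 := by
  intro h
  obtain ⟨H', -, hm, -⟩ := IsGoodStep.exists_option (H := ⟨0, isLeftDeadEnd_zero⟩) hρ h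
  exact not_mem_rightOptions_zero hm

theorem IsGoodStep.multiset_sum (hρ : IsOptionRank ρ) (s : Multiset LeftDeadEndMonoid) :
    ∀ x', IsGoodStep ρ x' s.sum →
      ∃ a u, s = a ::ₘ u ∧ ∃ a', IsGoodStep ρ a' a ∧ x' = a' + u.sum := by
  induction s using Multiset.induction with
  | empty => exact fun x' h => (not_isGoodStep_zero hρ x' h).elim
  | cons a s ih =>
    intro x' h
    rw [Multiset.sum_cons] at h
    rcases h.add hρ with ⟨a', ha', rfl⟩ | ⟨y', hy', rfl⟩
    · exact ⟨a, s, rfl, a', ha', rfl⟩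
    · obtain ⟨b, u, rfl, b', hb', rfl⟩ := ih y' hy'
      exact ⟨b, a ::ₘ u, Multiset.cons_swap a b u, b', hb', by
        rw [Multiset.sum_cons, add_left_comm]⟩

/-- The hypothesis concerns only the forms in `S`; it covers all good steps of their values because
a good step is realised in every form. -/
theorem isUniquelyFactorisable_sum (hρ : IsOptionRank ρ) {S : Set LeftDeadEnd}
    (hS : ∀ G ∈ S, AddIrreducible G.value)
    (h : ∀ G ∈ S, ∀ G' : LeftDeadEnd, IsGoodOption G'.1 G.1 →
      G'.1 ∈ G.1.options ∧ ρ G'.1 + 1 = ρ G.1 → IsPrimeFactorisable G'.value)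
    (s : Multiset LeftDeadEnd) (hs : ∀ G ∈ s, G ∈ S) :
    IsUniquelyFactorisable (s.map LeftDeadEnd.value).sum := by
  have hs' : ∀ a ∈ s.map LeftDeadEnd.value, AddIrreducible a ∧
      ∀ a', IsGoodStep ρ a' a → IsPrimeFactorisable a' := by
    intro a ha
    obtain ⟨G, hG, rfl⟩ := Multiset.mem_map.1 ha
    refine ⟨hS G (hs G hG), fun a' ha' => ?_⟩
    obtain ⟨G', rfl, hm, hgood, hr⟩ := ha'.exists_option hρ
    exact h G (hs G hG) G' hgood ⟨Or.inr hm, hr⟩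
  exact ⟨s.map LeftDeadEnd.value, ⟨fun a ha => (hs' a ha).1, rfl⟩, fun t ht =>
    eq_of_sum_eq_of_steps exists_isFactorisation (exists_isGoodStep hρ)
      (IsGoodStep.multiset_sum hρ) _ hs' t ht.1 ht.2⟩

end LeftDeadEndMonoid

theorem mainTheorem9 :
    (∀ S : Set LeftDeadEnd,
      (∀ G ∈ S, AddIrreducible G.value) →
      (∀ G ∈ S, ∀ G' : LeftDeadEnd, ShortGame.IsGoodOption G'.1 G.1 →
        ShortGame.IsRacingOption G'.1 G.1 → IsPrimeFactorisable G'.value) →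
      ∀ s : Multiset LeftDeadEnd, (∀ G ∈ s, G ∈ S) →
        IsUniquelyFactorisable (s.map LeftDeadEnd.value).sum) ∧
    (∀ S : Set LeftDeadEnd,
      (∀ G ∈ S, AddIrreducible G.value) →
      (∀ G ∈ S, ∀ G' : LeftDeadEnd, ShortGame.IsGoodOption G'.1 G.1 →
        ShortGame.IsStallingOption G'.1 G.1 → IsPrimeFactorisable G'.value) →
      ∀ s : Multiset LeftDeadEnd, (∀ G ∈ s, G ∈ S) →
        IsUniquelyFactorisable (s.map LeftDeadEnd.value).sum) := by
  exact ⟨fun S hS h => LeftDeadEndMonoid.isUniquelyFactorisable_sum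
      ShortGame.isOptionRank_race hS h,
    fun S hS h => LeftDeadEndMonoid.isUniquelyFactorisable_sum
      ShortGame.isOptionRank_birthday hS h⟩
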